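/- Let $k,n\ge 1$ be integers, let $\phi:\mathbb{R}\to[-1,1]$ be measurable with $\phi(z)\to-1$ as $z\to-\infty$ and $\phi(z)\to1$ as $z\to\infty$, and let $\mathcal{H}^\phi_k$ be the set of all functions $h:\mathbb{R}^d\to\mathbb{R}$ of the form $h(x)=c_0+\sum_{l=1}^k c_l\,\phi(a_l\cdot x+b_l)$ with $a_l\in\mathbb{R}^d$ and $b_l,c_l\in\mathbb{R}$. Let $B\subset\mathbb{R}^d$ be a bounded set containing $0$. Let $\Gamma_B$ be the set of all functions $h:B\to\mathbb{R}$ such that $$h(x)=h(0)+\int_{\mathbb{R}^d}\left(e^{\mathrm{i}\omega\cdot x}-1\right)\hat H(\mathrm{d}\omega),\qquad x\in B,$$ for some complex-valued measure $\hat H$ with $\int|\omega|\,|\hat H|(\mathrm{d}\omega)<\infty$ (infinite mass of $|\hat H|$ near $\omega=0$ being allowed), and for $h\in\Gamma_B$ let $C_h=\inf_{\hat H}\int\sup_{x\in B}|\omega\cdot x|\,|\hat H|(\mathrm{d}\omega)$, where the infimum is over all such representing measures $\hat H$ of $h$. Let $(X,Y)$ be a random pair with $Y\in\{\pm1\}$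 and $X\in B$ almost surely. Assume that $p=\mathbb{P}(Y=1)\in(0,1)$ and that, given $Y=\pm1$, $X$ has a conditional density $f_\pm$ on $\mathbb{R}^d$ with $f_\pm>0$ on $B$; put $\bar p=1-p$ and $$\theta(x)=\frac12\log\left(\frac{p f_+(x)}{\bar p f_-(x)}\right),\qquad x\in B.$$ Let $(X_1,Y_1),\dots,(X_n,Y_n)$ be i.i.d. copies of $(X,Y)$, and let $$\mathrm{mmse}(Y|X)=\inf_{h\text{ Borel}}\mathbb{E}\left[(Y-h(X))^2\right],\qquad \mathrm{mmse}^*_{k,n}(Y|X)=\inf_{h\in\mathcal{H}^\phi_k}\frac1n\sum_{i=1}^n\left(Y_i-\tanh(h(X_i))\right)^2.$$ If $\theta\in\Gamma_B$, then for every $\delta\in(0,1]$, with probability at least $1-\delta$, $$\mathrm{mmse}^*_{k,n}(Y|X)-\left(2\sqrt{\frac{2\log(1/\delta)}{n}}+\frac{4C_\theta^2}{k}+\frac{8C_\theta}{\sqrt k}\right)\le\mathrm{mmse}(Y|X).$$ -/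

import Mathlib

open MeasureTheory Filter Topology

noncomputable section

/-- A sigmoidal function `φ : ℝ → [-1, 1]`: measurable, with limit `-1` at `-∞` and `1` at `+∞`. -/
structure IsSigmoidal (φ : ℝ → ℝ) : Prop where
  measurable : Measurable φ
  abs_le_one : ∀ z, |φ z| ≤ 1
  tendsto_atBot : Tendsto φ atBot (𝓝 (-1))
  tendsto_atTop : Tendsto φ atTop (𝓝 1)

/-- Two-layer neural networks of size `k` with activation `φ`: the functions
`h x = c₀ + ∑ l, c l * φ (a l ⬝ x + b l)` on `ℝ^d`. -/
def twoLayerNN (φ : ℝ → ℝ) (d k : ℕ) : Set (EuclideanSpace ℝ (Fin d) → ℝ) :=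
  {h | ∃ (c₀ : ℝ) (a : Fin k → EuclideanSpace ℝ (Fin d)) (b c : Fin k → ℝ),
    ∀ x, h x = c₀ + ∑ l, c l * φ (inner ℝ (a l) x + b l)}

/-- The estimator `mmse*_{k,n}` computed from a sample `(xs i, ys i)`, `i : Fin n`: the least
empirical square loss of `tanh ∘ h` over the networks `h` of size `k`. -/
def empiricalTanhMMSE (φ : ℝ → ℝ) {d n : ℕ} (k : ℕ)
    (xs : Fin n → EuclideanSpace ℝ (Fin d)) (ys : Fin n → ℝ) : ℝ :=
  ⨅ h : twoLayerNN φ d k, (1 / (n : ℝ)) * ∑ i, (ys i - Real.tanh (h.1 (xs i))) ^ 2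

/-- The minimum mean square error `inf_h E[(Y - h(X))²]` over all Borel functions `h`. The
expectations are taken in `[0, ∞]`, so that an `h` with infinite loss does not count as zero. -/
def mmse {Ω : Type*} [MeasurableSpace Ω] {d : ℕ} (P : Measure Ω)
    (X : Ω → EuclideanSpace ℝ (Fin d)) (Y : Ω → ℝ) : ℝ :=
  (⨅ h : {h : EuclideanSpace ℝ (Fin d) → ℝ // Measurable h},
    ∫⁻ ω, ENNReal.ofReal ((Y ω - h.1 (X ω)) ^ 2) ∂P).toReal

/-- `f` is (a version of) the conditional Lebesgue density of `X` given the event `A`, an event of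
positive probability. -/
structure IsCondDensity {Ω : Type*} [MeasurableSpace Ω] {d : ℕ} (P : Measure Ω)
    (X : Ω → EuclideanSpace ℝ (Fin d)) (A : Set Ω) (f : EuclideanSpace ℝ (Fin d) → ℝ) : Prop where
  event_ne_zero : P A ≠ 0
  measurable : Measurable f
  nonneg : ∀ x, 0 ≤ f x
  map_eq : (ProbabilityTheory.cond P A).map X
    = (volume : Measure (EuclideanSpace ℝ (Fin d))).withDensity (fun x => ENNReal.ofReal (f x))

/-- The complex-valued measure `Ĥ(dω) = g(ω) F(dω)`, with `F = |Ĥ|` its variation and `g` its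
phase (`‖g‖ = 1`), represents `h` on `B`:
`h(x) = h(0) + ∫ (exp(i ω ⬝ x) - 1) Ĥ(dω)` for `x ∈ B`, and `∫ |ω| |Ĥ|(dω) < ∞`.
By the polar decomposition, every complex measure has this form; `F` is only asked to integrate
`|ω|`, so infinite mass at the origin (where the integrand vanishes) is allowed too.
Only the values of `h` on `B ∪ {0}` matter. -/
structure IsBarronRep {d : ℕ} (B : Set (EuclideanSpace ℝ (Fin d)))
    (h : EuclideanSpace ℝ (Fin d) → ℝ) (F : Measure (EuclideanSpace ℝ (Fin d)))
    (g : EuclideanSpace ℝ (Fin d) → ℂ) : Prop where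
  measurable_phase : Measurable g
  norm_phase : ∀ ω, ‖g ω‖ = 1
  integrable_norm : Integrable (fun ω => ‖ω‖) F
  eq_on : ∀ x ∈ B, (h x : ℂ)
    = (h 0 : ℂ) + ∫ ω, (Complex.exp (Complex.I * ((inner ℝ ω x : ℝ) : ℂ)) - 1) * g ω ∂F

/-- The class `Γ_B` of functions on `B` having such an integral representation. -/
def MemBarronClass {d : ℕ} (B : Set (EuclideanSpace ℝ (Fin d)))
    (h : EuclideanSpace ℝ (Fin d) → ℝ) : Prop :=
  ∃ F g, IsBarronRep B h F g

/-- `|ω|_B = sup_{x ∈ B} |ω ⬝ x|`. -/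
def supInner {d : ℕ} (B : Set (EuclideanSpace ℝ (Fin d))) (ω : EuclideanSpace ℝ (Fin d)) : ℝ :=
  ⨆ x : B, |inner ℝ ω (x : EuclideanSpace ℝ (Fin d))|

/-- The Barron constant `C_h = inf_Ĥ ∫ |ω|_B |Ĥ|(dω)`, over all `Ĥ` representing `h` on `B`. -/
def barronConst {d : ℕ} (B : Set (EuclideanSpace ℝ (Fin d)))
    (h : EuclideanSpace ℝ (Fin d) → ℝ) : ℝ :=
  sInf {C | ∃ F g, IsBarronRep B h F g ∧ C = ∫ ω, supInner B ω ∂F}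

/-- Half the log-likelihood ratio, `θ(x) = (1/2) log (p f₊(x) / ((1 - p) f₋(x)))`. -/
def halfLogRatio {d : ℕ} (p : ℝ) (fpos fneg : EuclideanSpace ℝ (Fin d) → ℝ)
    (x : EuclideanSpace ℝ (Fin d)) : ℝ :=
  1 / 2 * Real.log (p * fpos x / ((1 - p) * fneg x))

end

/-!
The half log-likelihood ratio `θ` satisfies `E[Y | X] = tanh (θ X)`, so for every predictor `q` with
values in `[-1, 1]` Pythagoras gives
`E (Y - q X)² = mmse + E (tanh (θ X) - q X)²`
(`integral_sq_sub_eq_add`, `integral_sq_sub_tanh_le_mmse`). As `tanh` is `1`-Lipschitz, the excess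
risk of `tanh ∘ N` is at most `E (θ X - N X)²`. It suffices to find one deterministic network `N`
for which this is at most `4 C² / k + 8 C / √k`, `C` being the Barron constant; Hoeffding's
inequality for the single predictor `tanh ∘ N` (`exists_event_empirical_loss_le`) then compares the
empirical and the true risk, and the empirical minimum is no larger than the empirical risk of `N`.

The network comes from Barron's argument. A cosine profile on `[-r, r]` is a constant plus an
average of signed steps weighted by its derivative (`cos_sub_cos_eq_integral_stepFun`). Applied with
`r = |ω|_B` under the Fourier integral, this writes `θ` on `B` as a constant plus the mean of a
random ridge function bounded by `∫ |ω|_B F(dω)` (`IsBarronRep.exists_eq_add_integral_ridge`). Steps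
are limits of steep sigmoids (`tendsto_integral_ridge`), and the mean of a dictionary bounded by `M`
is approximated in `L²` by an average of `k` of its members with squared error `M² / k`
(`exists_integral_sq_sub_average_le`). With step functions of values `±1` this yields
`(∫ |ω|_B dF)² / k` up to any `ε > 0`, which for a representation of mass at most `2 C` is below the
bound as soon as `C > 0`; for `C = 0` the function `θ` is constant on `B`
(`MemBarronClass.exists_twoLayerNN`).
-/

/-! ### Analytic preliminaries -/

lemma measurable_tanh : Measurable Real.tanh := by
  have : Real.tanh = fun x => (Real.exp x - Real.exp (-x)) / (Real.exp x + Real.exp (-x)) := by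
    funext x; exact Real.tanh_eq x
  rw [this]; fun_prop

lemma abs_tanh_sub_tanh_le (a b : ℝ) : |Real.tanh a - Real.tanh b| ≤ |a - b| := by
  have hd : ∀ x, HasDerivAt Real.tanh (1 / Real.cosh x ^ 2) x := by
    intro x
    have h := (Real.hasDerivAt_sinh x).div (Real.hasDerivAt_cosh x) (Real.cosh_pos x).ne'
    have he : Real.tanh = fun y => Real.sinh y / Real.cosh y := by
      funext y; exact Real.tanh_eq_sinh_div_cosh y
    have hv : 1 / Real.cosh x ^ 2
        = (Real.cosh x * Real.cosh x - Real.sinh x * Real.sinh x) / Real.cosh x ^ 2 := by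
      rw [← Real.cosh_sq_sub_sinh_sq x]; ring
    rw [he, hv]
    exact h
  have := convex_univ.norm_image_sub_le_of_norm_hasDerivWithin_le (f := Real.tanh) (C := 1)
    (fun x _ => (hd x).hasDerivWithinAt) (fun x _ => by
      rw [Real.norm_eq_abs, abs_of_nonneg (by positivity)]
      rw [div_le_one (pow_pos (Real.cosh_pos x) 2)]
      exact one_le_pow₀ (Real.one_le_cosh x)) (Set.mem_univ b) (Set.mem_univ a)
  simpa using this

/-! ### The seminorm `|ω|_B` -/

section supInner
variable {d : ℕ} {B : Set (EuclideanSpace ℝ (Fin d))}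

lemma exists_abs_inner_le (hB : Bornology.IsBounded B) :
    ∃ R : ℝ, 0 ≤ R ∧ ∀ x ∈ B, ∀ ω, |inner ℝ ω x| ≤ R * ‖ω‖ := by
  obtain ⟨R, hR⟩ := hB.exists_norm_le
  refine ⟨max R 0, le_max_right _ _, fun x hx ω => (abs_real_inner_le_norm ω x).trans ?_⟩
  rw [mul_comm]
  exact mul_le_mul_of_nonneg_right ((hR x hx).trans (le_max_left _ _)) (norm_nonneg _)

lemma bddAbove_abs_inner (hB : Bornology.IsBounded B) (ω : EuclideanSpace ℝ (Fin d)) :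
    BddAbove (Set.range fun x : B => |inner ℝ ω (x : EuclideanSpace ℝ (Fin d))|) := by
  obtain ⟨R, -, hR⟩ := exists_abs_inner_le hB
  exact ⟨R * ‖ω‖, by rintro _ ⟨x, rfl⟩; exact hR x x.2 ω⟩

lemma abs_inner_le_supInner (hB : Bornology.IsBounded B) {x : EuclideanSpace ℝ (Fin d)}
    (hx : x ∈ B) (ω : EuclideanSpace ℝ (Fin d)) : |inner ℝ ω x| ≤ supInner B ω :=
  le_ciSup (bddAbove_abs_inner hB ω) (⟨x, hx⟩ : B)

lemma supInner_nonneg (B : Set (EuclideanSpace ℝ (Fin d))) (ω : EuclideanSpace ℝ (Fin d)) :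
    0 ≤ supInner B ω :=
  Real.iSup_nonneg fun _ => abs_nonneg _

lemma measurable_supInner (hB : Bornology.IsBounded B) : Measurable (supInner B) := by
  refine LowerSemicontinuous.measurable ?_
  refine lowerSemicontinuous_ciSup (bddAbove_abs_inner hB) fun x => ?_
  exact Continuous.lowerSemicontinuous (by fun_prop)

lemma integrable_supInner (hB : Bornology.IsBounded B) {F : Measure (EuclideanSpace ℝ (Fin d))}
    (hF : Integrable (fun ω => ‖ω‖) F) : Integrable (supInner B) F := by
  obtain ⟨R, hR0, hR⟩ := exists_abs_inner_le hB
  refine (hF.const_mul R).mono' (measurable_supInner hB).aestronglyMeasurable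
    (Eventually.of_forall fun ω => ?_)
  rw [Real.norm_of_nonneg (supInner_nonneg B ω)]
  exact Real.iSup_le (fun x => hR x x.2 ω) (by positivity)

end supInner

/-! ### Steps and cosine profiles -/

/-- The sign function with the value `1` at `0`: the limit of `z ↦ φ (l * z)` as `l → ∞`, off the
origin, for every sigmoidal `φ`. -/
noncomputable def stepFun (z : ℝ) : ℝ := if 0 ≤ z then 1 else -1

lemma measurable_stepFun : Measurable stepFun :=
  Measurable.ite measurableSet_Ici measurable_const measurable_const

lemma abs_stepFun (z : ℝ) : |stepFun z| = 1 := by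
  unfold stepFun; split_ifs <;> simp

lemma IsSigmoidal.tendsto_stepFun {φ : ℝ → ℝ} (hφ : IsSigmoidal φ) {z : ℝ} (hz : z ≠ 0) :
    Tendsto (fun l : ℕ => φ (l * z)) atTop (𝓝 (stepFun z)) := by
  have hl : Tendsto (fun l : ℕ => (l : ℝ)) atTop atTop := tendsto_natCast_atTop_atTop
  rcases lt_or_gt_of_ne hz with h | h
  · rw [stepFun, if_neg (not_le.2 h)]
    exact hφ.tendsto_atBot.comp (hl.atTop_mul_const_of_neg h)
  · rw [stepFun, if_pos h.le]
    exact hφ.tendsto_atTop.comp (hl.atTop_mul_const h)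

/-- A cosine ridge profile on `[-r, r]` is, up to a constant, the average of the steps
`stepFun (y - r * t)`, `t ∈ [-1, 1]`, weighted by its derivative. -/
lemma cos_sub_cos_eq_integral_stepFun {r y : ℝ} (hr : 0 < r) (hy : |y| ≤ r) (a : ℝ) :
    Real.cos (y + a) - Real.cos a = Real.cos a * (Real.cos r - 1)
      + r / 2 * ∫ t in (-1 : ℝ)..1, -Real.sin (r * t + a) * stepFun (y - r * t) := by
  have hy' := abs_le.1 hy
  set u := y / r with hu
  have hru : r * u = y := by rw [hu]; field_simp
  have h1 : -1 ≤ u := by rw [hu, le_div_iff₀ hr]; linarith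
  have h2 : u ≤ 1 := by rw [hu, div_le_one hr]; linarith
  have hd : ∀ t, HasDerivAt (fun t => Real.cos (r * t + a) / r) (-Real.sin (r * t + a)) t := by
    intro t
    have h := ((((hasDerivAt_id t).const_mul r).add_const a).cos).div_const r
    have hv : -Real.sin (r * t + a) = -Real.sin (r * id t + a) * (r * 1) / r := by
      simp only [id]; field_simp
    rw [hv]
    exact h
  have hint : ∀ p q, ∫ t in p..q, -Real.sin (r * t + a)
      = Real.cos (r * q + a) / r - Real.cos (r * p + a) / r := fun p q =>
    intervalIntegral.integral_eq_sub_of_hasDerivAt (fun t _ => hd t)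
      (Continuous.intervalIntegrable (by fun_prop) _ _)
  have e1 : Set.EqOn (fun t => -Real.sin (r * t + a) * stepFun (y - r * t))
      (fun t => -Real.sin (r * t + a)) (Set.Ioo (-1) u) := by
    intro t ht
    have : r * t ≤ r * u := mul_le_mul_of_nonneg_left ht.2.le hr.le
    simp only [stepFun]; rw [if_pos (by linarith)]; ring
  have e2 : Set.EqOn (fun t => -Real.sin (r * t + a) * stepFun (y - r * t))
      (fun t => Real.sin (r * t + a)) (Set.Ioo u 1) := by
    intro t ht
    have : r * u < r * t := mul_lt_mul_of_pos_left ht.1 hr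
    simp only [stepFun]; rw [if_neg (by linarith)]; ring
  have hint' : ∀ p q, ∫ t in p..q, Real.sin (r * t + a)
      = Real.cos (r * p + a) / r - Real.cos (r * q + a) / r := fun p q => by
    have h := hint p q
    rw [intervalIntegral.integral_neg] at h
    linarith
  have hi : ∀ p q, IntervalIntegrable
      (fun t => -Real.sin (r * t + a) * stepFun (y - r * t)) volume p q := by
    intro p q
    have hc : IntervalIntegrable (fun _ : ℝ => (1 : ℝ)) volume p q := intervalIntegrable_const
    refine hc.mono_fun ?_ (Eventually.of_forall fun t => ?_)
    · have := measurable_stepFun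
      exact Measurable.aestronglyMeasurable (by fun_prop)
    · simp [abs_stepFun, Real.abs_sin_le_one]
  rw [← intervalIntegral.integral_add_adjacent_intervals (hi (-1) u) (hi u 1),
    intervalIntegral.integral_congr_Ioo_of_le h1 e1,
    intervalIntegral.integral_congr_Ioo_of_le h2 e2, hint, hint', hru]
  have c1 : Real.cos (r * 1 + a) = Real.cos r * Real.cos a - Real.sin r * Real.sin a := by
    rw [mul_one, Real.cos_add]
  have c2 : Real.cos (r * -1 + a) = Real.cos r * Real.cos a + Real.sin r * Real.sin a := by
    rw [mul_neg_one, Real.cos_add, Real.cos_neg, Real.sin_neg]; ring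
  rw [c1, c2]
  field_simp
  ring

/-! ### Sampling from a dictionary -/

section Sampling

lemma integrable_of_abs_le {S : Type*} [MeasurableSpace S] {Q : Measure S} [IsFiniteMeasure Q]
    {f : S → ℝ} (hf : Measurable f) {M : ℝ} (h : ∀ s, |f s| ≤ M) : Integrable f Q :=
  Integrable.of_bound hf.aestronglyMeasurable M (Eventually.of_forall h)

variable {S E : Type*} [MeasurableSpace S] [MeasurableSpace E] {Q : Measure S} {μ : Measure E}

lemma measurable_mean [SFinite Q] {ψ : S → E → ℝ} (hψ : Measurable (Function.uncurry ψ)) :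
    Measurable fun x => ∫ s, ψ s x ∂Q := by
  have h : Measurable (Function.uncurry fun (x : E) (s : S) => ψ s x) := hψ.comp measurable_swap
  exact h.stronglyMeasurable.integral_prod_right.measurable

variable [IsProbabilityMeasure Q]

lemma abs_integral_le_of_abs_le {f : S → ℝ} {M : ℝ} (h : ∀ s, |f s| ≤ M) :
    |∫ s, f s ∂Q| ≤ M := by
  have := norm_integral_le_of_norm_le_const (μ := Q) (f := f) (C := M) (Eventually.of_forall h)
  simpa using this

variable [IsProbabilityMeasure μ]

/-- One greedy step: averaging over `s` kills the cross term, so some `s` does as well as the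
average, which adds at most the variance. -/
lemma exists_integral_sq_add_mean_sub_le {ψ : S → E → ℝ} (hψ : Measurable (Function.uncurry ψ))
    {M : ℝ} (hM : ∀ s x, |ψ s x| ≤ M) {R : E → ℝ} (hR : Measurable R) {K : ℝ}
    (hK : ∀ x, |R x| ≤ K) :
    ∃ s, ∫ x, (R x + ((∫ s', ψ s' x ∂Q) - ψ s x)) ^ 2 ∂μ ≤ (∫ x, R x ^ 2 ∂μ) + M ^ 2 := by
  set m : E → ℝ := fun x => ∫ s', ψ s' x ∂Q with hm
  have hψx : ∀ x, Measurable fun s => ψ s x :=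
    fun x => hψ.comp (by fun_prop : Measurable fun s => (s, x))
  have hmm : Measurable m := measurable_mean hψ
  have hmM : ∀ x, |m x| ≤ M := fun x => abs_integral_le_of_abs_le fun s => hM s x
  let G : S × E → ℝ := fun z => (R z.2 + (m z.2 - ψ z.1 z.2)) ^ 2
  have hG : Measurable G := by
    have h : Measurable fun z : S × E => ψ z.1 z.2 := hψ
    fun_prop
  have hGi : Integrable G (Q.prod μ) := by
    refine integrable_of_abs_le hG (M := (K + (M + M)) ^ 2) fun z => ?_
    rw [abs_pow]
    gcongr
    refine (abs_add_le _ _).trans (add_le_add (hK _) ((abs_sub _ _).trans ?_))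
    exact add_le_add (hmM _) (hM _ _)
  obtain ⟨s, hs⟩ := exists_le_integral hGi.integral_prod_left
  refine ⟨s, hs.trans ?_⟩
  rw [integral_integral_swap hGi]
  have hRi : Integrable (fun x => R x ^ 2) μ :=
    integrable_of_abs_le (hR.pow_const 2) (M := K ^ 2) fun x => by
      rw [abs_pow]; gcongr; exact hK x
  have hconst : (∫ x, R x ^ 2 ∂μ) + M ^ 2 = ∫ x, (R x ^ 2 + M ^ 2) ∂μ := by
    rw [integral_add hRi (integrable_const _)]; simp
  rw [hconst]
  refine integral_mono hGi.integral_prod_right (hRi.add (integrable_const _)) fun x => ?_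
  have hi1 : Integrable (fun s => ψ s x) Q := integrable_of_abs_le (hψx x) fun s => hM s x
  have hi2 : Integrable (fun s => ψ s x ^ 2) Q :=
    integrable_of_abs_le ((hψx x).pow_const 2) (M := M ^ 2) fun s => by
      rw [abs_pow]; gcongr; exact hM s x
  have hexp : (fun s => G (s, x))
      = fun s => ((R x + m x) ^ 2 - 2 * (R x + m x) * ψ s x) + ψ s x ^ 2 := by
    funext s; simp only [G]; ring
  have hle : ∫ s, ψ s x ^ 2 ∂Q ≤ M ^ 2 := by
    refine (le_abs_self _).trans (abs_integral_le_of_abs_le fun s => ?_)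
    rw [abs_pow]; gcongr; exact hM s x
  have hval : ∫ s, G (s, x) ∂Q = (R x + m x) ^ 2 - 2 * (R x + m x) * m x + ∫ s, ψ s x ^ 2 ∂Q := by
    have hi3 : Integrable (fun s => (R x + m x) ^ 2 - 2 * (R x + m x) * ψ s x) Q :=
      (integrable_const _).sub (hi1.const_mul _)
    rw [hexp, integral_add hi3 hi2, integral_sub (integrable_const _) (hi1.const_mul _), integral_const_mul]
    simp [hm]
  change ∫ s, G (s, x) ∂Q ≤ R x ^ 2 + M ^ 2
  rw [hval]
  nlinarith [sq_nonneg (m x)]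

/-- Iterating the greedy step `k` times from the residual `R`. -/
lemma exists_integral_sq_add_sum_le {ψ : S → E → ℝ} (hψ : Measurable (Function.uncurry ψ))
    {M : ℝ} (hM : ∀ s x, |ψ s x| ≤ M) {R : E → ℝ} (hR : Measurable R) {K : ℝ}
    (hK : ∀ x, |R x| ≤ K) (k : ℕ) :
    ∃ s : Fin k → S, ∫ x, (R x + ∑ l, ((∫ s', ψ s' x ∂Q) - ψ (s l) x)) ^ 2 ∂μ
      ≤ (∫ x, R x ^ 2 ∂μ) + k * M ^ 2 := by
  induction k with
  | zero => exact ⟨Fin.elim0, by simp⟩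
  | succ k ih =>
    obtain ⟨s, hs⟩ := ih
    have hψx : ∀ s, Measurable fun x => ψ s x :=
      fun s => hψ.comp (by fun_prop : Measurable fun x => (s, x))
    have hmm : Measurable fun x => ∫ s', ψ s' x ∂Q := measurable_mean hψ
    obtain ⟨s', hs'⟩ := exists_integral_sq_add_mean_sub_le (Q := Q) (μ := μ) hψ hM
      (R := fun x => R x + ∑ l, ((∫ s', ψ s' x ∂Q) - ψ (s l) x))
      (K := K + ∑ _l : Fin k, (M + M))
      (hR.add (Finset.measurable_sum _ fun l _ => hmm.sub (hψx _)))
      (fun x => (abs_add_le _ _).trans (add_le_add (hK x)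
        ((Finset.abs_sum_le_sum_abs _ _).trans (Finset.sum_le_sum fun l _ =>
          (abs_sub _ _).trans (add_le_add
            (abs_integral_le_of_abs_le fun s => hM s x) (hM _ _))))))
    refine ⟨Fin.snoc s s', ?_⟩
    simp only [Fin.sum_univ_castSucc, Fin.snoc_castSucc, Fin.snoc_last, ← add_assoc] at hs' ⊢
    refine hs'.trans ?_
    push_cast
    linarith

/-- **Maurey's lemma** with a perturbed dictionary: a function `f` close to the mean of `ψ` is
approximated by an average of `k` members of `ψ`, with squared error `M² / k` on top. -/
lemma exists_integral_sq_sub_average_le {ψ : S → E → ℝ} (hψ : Measurable (Function.uncurry ψ))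
    {M : ℝ} (hM : ∀ s x, |ψ s x| ≤ M) {f : E → ℝ} (hf : Measurable f) {K : ℝ}
    (hK : ∀ x, |f x| ≤ K) {k : ℕ} (hk : 0 < k) :
    ∃ s : Fin k → S, ∫ x, (f x - (1 / k : ℝ) * ∑ l, ψ (s l) x) ^ 2 ∂μ
      ≤ (∫ x, (f x - ∫ s, ψ s x ∂Q) ^ 2 ∂μ) + M ^ 2 / k := by
  have hmm : Measurable fun x => ∫ s', ψ s' x ∂Q := measurable_mean hψ
  have hk' : (0 : ℝ) < k := by exact_mod_cast hk
  obtain ⟨s, hs⟩ := exists_integral_sq_add_sum_le (Q := Q) (μ := μ) hψ hM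
    (R := fun x => k * (f x - ∫ s, ψ s x ∂Q)) (K := k * (K + M))
    (measurable_const.mul (hf.sub hmm)) (fun x => by
      rw [abs_mul, abs_of_pos hk']
      gcongr
      exact (abs_sub _ _).trans (add_le_add (hK x) (abs_integral_le_of_abs_le fun s => hM s x))) k
  refine ⟨s, ?_⟩
  have e1 : ∀ x, (k * (f x - ∫ s, ψ s x ∂Q) + ∑ l, ((∫ s', ψ s' x ∂Q) - ψ (s l) x)) ^ 2
      = k ^ 2 * (f x - (1 / k : ℝ) * ∑ l, ψ (s l) x) ^ 2 := by
    intro x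
    rw [Finset.sum_sub_distrib, Finset.sum_const, Finset.card_univ, Fintype.card_fin, nsmul_eq_mul]
    field_simp
    ring
  have e2 : ∀ x, (k * (f x - ∫ s, ψ s x ∂Q)) ^ 2 = (k : ℝ) ^ 2 * (f x - ∫ s, ψ s x ∂Q) ^ 2 :=
    fun x => by ring
  simp only [e1, e2, integral_const_mul] at hs
  have h3 : (k : ℝ) * M ^ 2 = k ^ 2 * (M ^ 2 / k) := by field_simp
  rw [h3, ← mul_add] at hs
  exact le_of_mul_le_mul_left hs (by positivity)

end Sampling

/-! ### Barron representations as mixtures of ridge functions -/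

section Ridge
variable {d : ℕ} {B : Set (EuclideanSpace ℝ (Fin d))} {h : EuclideanSpace ℝ (Fin d) → ℝ}
  {F : Measure (EuclideanSpace ℝ (Fin d))} {g : EuclideanSpace ℝ (Fin d) → ℂ}

/-- The real part of the Barron integrand with phase `w`. -/
lemma re_exp_sub_one_mul {w : ℂ} (hw : ‖w‖ = 1) (y : ℝ) :
    ((Complex.exp (Complex.I * (y : ℂ)) - 1) * w).re = Real.cos (y + w.arg) - Real.cos w.arg := by
  have hw' : w = Complex.exp (w.arg * Complex.I) := by
    have := Complex.norm_mul_exp_arg_mul_I w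
    rw [hw] at this
    simpa using this.symm
  have e : (Complex.exp (Complex.I * (y : ℂ)) - 1) * w
      = Complex.exp (((y + w.arg : ℝ) : ℂ) * Complex.I) - Complex.exp (w.arg * Complex.I) := by
    conv_lhs => rw [hw']
    rw [sub_mul, one_mul, ← Complex.exp_add]
    congr 2
    push_cast; ring
  rw [e, Complex.sub_re, Complex.exp_ofReal_mul_I_re, Complex.exp_ofReal_mul_I_re]

lemma abs_cos_sub_one_le (r : ℝ) : |Real.cos r - 1| ≤ |r| := by
  have h1 := re_exp_sub_one_mul (w := 1) (by simp) r
  have h2 := (Complex.abs_re_le_norm _).trans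
    (Real.norm_exp_I_mul_ofReal_sub_one_le (x := r))
  simp only [mul_one, Complex.arg_one, add_zero, Real.cos_zero] at h1
  rw [h1] at h2
  simpa using h2

lemma IsBarronRep.norm_integrand_le (hB : Bornology.IsBounded B) (hrep : IsBarronRep B h F g)
    {x : EuclideanSpace ℝ (Fin d)} (hx : x ∈ B) (ω : EuclideanSpace ℝ (Fin d)) :
    ‖(Complex.exp (Complex.I * ((inner ℝ ω x : ℝ) : ℂ)) - 1) * g ω‖ ≤ supInner B ω := by
  rw [norm_mul, hrep.norm_phase, mul_one]
  exact Real.norm_exp_I_mul_ofReal_sub_one_le.trans (abs_inner_le_supInner hB hx ω)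

lemma IsBarronRep.integrable_integrand (hB : Bornology.IsBounded B) (hrep : IsBarronRep B h F g)
    {x : EuclideanSpace ℝ (Fin d)} (hx : x ∈ B) :
    Integrable (fun ω => (Complex.exp (Complex.I * ((inner ℝ ω x : ℝ) : ℂ)) - 1) * g ω) F := by
  have := hrep.measurable_phase
  exact (integrable_supInner hB hrep.integrable_norm).mono'
    (Measurable.aestronglyMeasurable (by fun_prop))
    (Eventually.of_forall (hrep.norm_integrand_le hB hx))

/-- The oscillation of a Barron function around `h 0` is at most the mass of any of its
representations; this settles the case of Barron constant zero. -/
lemma IsBarronRep.abs_sub_le (hB : Bornology.IsBounded B) (hrep : IsBarronRep B h F g)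
    {x : EuclideanSpace ℝ (Fin d)} (hx : x ∈ B) : |h x - h 0| ≤ ∫ ω, supInner B ω ∂F := by
  have e : ((h x - h 0 : ℝ) : ℂ)
      = ∫ ω, (Complex.exp (Complex.I * ((inner ℝ ω x : ℝ) : ℂ)) - 1) * g ω ∂F := by
    rw [Complex.ofReal_sub, hrep.eq_on x hx]; ring
  rw [← Real.norm_eq_abs, ← Complex.norm_real, e]
  exact norm_integral_le_of_norm_le (integrable_supInner hB hrep.integrable_norm)
    (Eventually.of_forall (hrep.norm_integrand_le hB hx))

lemma IsBarronRep.eq_integral_cos (hB : Bornology.IsBounded B) (hrep : IsBarronRep B h F g)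
    {x : EuclideanSpace ℝ (Fin d)} (hx : x ∈ B) :
    Integrable (fun ω => Real.cos (inner ℝ ω x + (g ω).arg) - Real.cos (g ω).arg) F ∧
    h x = h 0 + ∫ ω, (Real.cos (inner ℝ ω x + (g ω).arg) - Real.cos (g ω).arg) ∂F := by
  have hi := hrep.integrable_integrand hB hx
  have hre := fun ω => re_exp_sub_one_mul (hrep.norm_phase ω) (inner ℝ ω x)
  have h1 := Complex.reCLM.integrable_comp hi
  have h2 := Complex.reCLM.integral_comp_comm hi
  simp only [Complex.reCLM_apply, hre] at h1 h2
  refine ⟨h1, ?_⟩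
  have h3 := congrArg Complex.re (hrep.eq_on x hx)
  rw [Complex.add_re, Complex.ofReal_re, Complex.ofReal_re] at h3
  rw [h3, h2]

/-- The uniform distribution on `[-1, 1]`. -/
noncomputable def uniformUnit : Measure ℝ :=
  (2⁻¹ : ENNReal) • volume.restrict (Set.Ioc (-1) 1)

instance : IsProbabilityMeasure uniformUnit := ⟨by
  simp only [uniformUnit, Measure.smul_apply, Measure.restrict_apply_univ, Real.volume_Ioc,
    smul_eq_mul]
  norm_num
  exact ENNReal.inv_mul_cancel (by simp) (by simp)⟩

lemma integral_uniformUnit (f : ℝ → ℝ) :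
    ∫ t, f t ∂uniformUnit = 1 / 2 * ∫ t in (-1 : ℝ)..1, f t := by
  rw [uniformUnit, integral_smul_measure, intervalIntegral.integral_of_le (by norm_num)]
  simp

/-- The law of a random ridge `(ω, t)`: the frequency `ω` is drawn with density proportional to
`|ω|_B` with respect to `F`, and the threshold `t`, in units of `|ω|_B`, uniformly. -/
noncomputable def ridgeMeasure (B : Set (EuclideanSpace ℝ (Fin d)))
    (F : Measure (EuclideanSpace ℝ (Fin d))) : Measure (EuclideanSpace ℝ (Fin d) × ℝ) :=
  ((ENNReal.ofReal (∫ ω, supInner B ω ∂F))⁻¹ •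
    F.withDensity fun ω => ENNReal.ofReal (supInner B ω)).prod uniformUnit

/-- The ridge function with parameters `s = (ω, t)` and profile `σ`, with total weight
`∫ |ω|_B F(dω)`. -/
noncomputable def ridge (B : Set (EuclideanSpace ℝ (Fin d)))
    (F : Measure (EuclideanSpace ℝ (Fin d))) (g : EuclideanSpace ℝ (Fin d) → ℂ) (σ : ℝ → ℝ)
    (s : EuclideanSpace ℝ (Fin d) × ℝ) (x : EuclideanSpace ℝ (Fin d)) : ℝ :=
  (∫ ω, supInner B ω ∂F) * (-Real.sin (supInner B s.1 * s.2 + (g s.1).arg)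
    * σ (inner ℝ s.1 x - supInner B s.1 * s.2))

lemma isProbabilityMeasure_tilt (hB : Bornology.IsBounded B)
    (hF : Integrable (fun ω => ‖ω‖) F) (hC : 0 < ∫ ω, supInner B ω ∂F) :
    IsProbabilityMeasure ((ENNReal.ofReal (∫ ω, supInner B ω ∂F))⁻¹ •
      F.withDensity fun ω => ENNReal.ofReal (supInner B ω)) := by
  constructor
  rw [Measure.smul_apply, withDensity_apply _ MeasurableSet.univ, Measure.restrict_univ,
    ← ofReal_integral_eq_lintegral_ofReal (integrable_supInner hB hF)
      (Eventually.of_forall (supInner_nonneg B)), smul_eq_mul]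
  exact ENNReal.inv_mul_cancel (by simpa using hC) ENNReal.ofReal_ne_top

lemma isProbabilityMeasure_ridgeMeasure (hB : Bornology.IsBounded B)
    (hF : Integrable (fun ω => ‖ω‖) F) (hC : 0 < ∫ ω, supInner B ω ∂F) :
    IsProbabilityMeasure (ridgeMeasure B F) := by
  have := isProbabilityMeasure_tilt hB hF hC
  unfold ridgeMeasure
  infer_instance

lemma measurable_uncurry_ridge (hB : Bornology.IsBounded B) (hg : Measurable g) {σ : ℝ → ℝ}
    (hσ : Measurable σ) : Measurable (Function.uncurry (ridge B F g σ)) := by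
  have := measurable_supInner hB
  unfold ridge Function.uncurry
  fun_prop

lemma measurable_ridge_left (hB : Bornology.IsBounded B) (hg : Measurable g) {σ : ℝ → ℝ}
    (hσ : Measurable σ) (x : EuclideanSpace ℝ (Fin d)) :
    Measurable fun s => ridge B F g σ s x := by
  have := measurable_supInner hB
  unfold ridge
  fun_prop

lemma measurable_ridge_right {σ : ℝ → ℝ} (hσ : Measurable σ)
    (s : EuclideanSpace ℝ (Fin d) × ℝ) : Measurable (ridge B F g σ s) := by
  unfold ridge
  fun_prop

lemma abs_ridge_le {σ : ℝ → ℝ} (hσ : ∀ z, |σ z| ≤ 1) (s : EuclideanSpace ℝ (Fin d) × ℝ)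
    (x : EuclideanSpace ℝ (Fin d)) : |ridge B F g σ s x| ≤ ∫ ω, supInner B ω ∂F := by
  have h0 : 0 ≤ ∫ ω, supInner B ω ∂F := integral_nonneg (supInner_nonneg B)
  rw [ridge, abs_mul, abs_of_nonneg h0, abs_mul, abs_neg]
  exact mul_le_of_le_one_right h0 (mul_le_one₀ (Real.abs_sin_le_one _) (abs_nonneg _) (hσ _))

/-- Every function with a Barron representation is, up to a constant, the mean of the random step
ridge. The constant also absorbs the midpoint terms of `cos_sub_cos_eq_integral_stepFun`, which are
integrable because `|cos r - 1| ≤ r`. -/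
lemma IsBarronRep.exists_eq_add_integral_ridge (hB : Bornology.IsBounded B)
    (hrep : IsBarronRep B h F g) (hC : 0 < ∫ ω, supInner B ω ∂F) :
    ∃ c₀ : ℝ, ∀ x ∈ B, h x = c₀ + ∫ s, ridge B F g stepFun s x ∂ridgeMeasure B F := by
  have hr := measurable_supInner hB
  have hg := hrep.measurable_phase
  refine ⟨h 0 + ∫ ω, Real.cos (g ω).arg * (Real.cos (supInner B ω) - 1) ∂F, fun x hx => ?_⟩
  obtain ⟨hi, he⟩ := hrep.eq_integral_cos hB hx
  set J : EuclideanSpace ℝ (Fin d) → ℝ := fun ω =>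
    ∫ t, -Real.sin (supInner B ω * t + (g ω).arg) * stepFun (inner ℝ ω x - supInner B ω * t)
      ∂uniformUnit with hJ
  have hpt : ∀ ω, Real.cos (inner ℝ ω x + (g ω).arg) - Real.cos (g ω).arg
      = Real.cos (g ω).arg * (Real.cos (supInner B ω) - 1) + supInner B ω * J ω := by
    intro ω
    have hle := abs_inner_le_supInner hB hx ω
    rcases (supInner_nonneg B ω).eq_or_lt with h0 | h0
    · rw [← h0] at hle ⊢
      have : inner ℝ ω x = (0 : ℝ) := abs_nonpos_iff.1 hle
      simp [this]
    · rw [cos_sub_cos_eq_integral_stepFun h0 hle, hJ]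
      simp only [integral_uniformUnit]
      ring
  have hK : Integrable (fun ω => Real.cos (g ω).arg * (Real.cos (supInner B ω) - 1)) F := by
    refine (integrable_supInner hB hrep.integrable_norm).mono'
      (Measurable.aestronglyMeasurable (by fun_prop)) (Eventually.of_forall fun ω => ?_)
    rw [norm_mul, Real.norm_eq_abs, Real.norm_eq_abs]
    refine (mul_le_of_le_one_left (abs_nonneg _) (Real.abs_cos_le_one _)).trans ?_
    exact (abs_cos_sub_one_le _).trans_eq (abs_of_nonneg (supInner_nonneg B ω))
  -- measurability of `J` is not needed: `|ω|_B * J` is a difference of integrable functions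
  have hrJ : Integrable (fun ω => supInner B ω * J ω) F := by
    refine (hi.sub hK).congr (Eventually.of_forall fun ω => ?_)
    simp only [Pi.sub_apply, hpt]; ring
  have := isProbabilityMeasure_tilt hB hrep.integrable_norm hC
  have := isProbabilityMeasure_ridgeMeasure hB hrep.integrable_norm hC
  have hint : Integrable (fun s => ridge B F g stepFun s x) (ridgeMeasure B F) :=
    integrable_of_abs_le
      (measurable_ridge_left hB hg measurable_stepFun x)
      (fun s => abs_ridge_le (fun z => (abs_stepFun z).le) s x)
  have hprod : ∫ s, ridge B F g stepFun s x ∂ridgeMeasure B F = ∫ ω, supInner B ω * J ω ∂F := by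
    unfold ridgeMeasure at hint ⊢
    rw [integral_prod _ hint, integral_smul_measure,
      integral_withDensity_eq_integral_toReal_smul (by fun_prop)
        (Eventually.of_forall fun _ => ENNReal.ofReal_lt_top), smul_eq_mul,
      ← integral_const_mul]
    refine integral_congr_ae (Eventually.of_forall fun ω => ?_)
    simp only [ridge, integral_const_mul, smul_eq_mul,
      ENNReal.toReal_ofReal (supInner_nonneg B ω), ENNReal.toReal_inv,
      ENNReal.toReal_ofReal hC.le, hJ]
    field_simp
  rw [he, integral_congr_ae (Eventually.of_forall hpt), integral_add hK hrJ, hprod]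
  ring

/-- Steepening the activation turns the mean sigmoidal ridge into the mean step ridge. Thresholds
lie off the boundary `⟪ω, x⟫ = |ω|_B t` almost surely, because `t` has a density. -/
lemma tendsto_integral_ridge (hB : Bornology.IsBounded B)
    (hF : Integrable (fun ω => ‖ω‖) F) (hg : Measurable g) (hC : 0 < ∫ ω, supInner B ω ∂F)
    {φ : ℝ → ℝ} (hφ : IsSigmoidal φ) (x : EuclideanSpace ℝ (Fin d)) :
    Tendsto (fun l : ℕ => ∫ s, ridge B F g (fun z => φ (l * z)) s x ∂ridgeMeasure B F) atTop
      (𝓝 (∫ s, ridge B F g stepFun s x ∂ridgeMeasure B F)) := by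
  have hr := measurable_supInner hB
  have hφm := hφ.measurable
  have := isProbabilityMeasure_tilt hB hF hC
  have := isProbabilityMeasure_ridgeMeasure hB hF hC
  refine tendsto_integral_of_dominated_convergence (fun _ => ∫ ω, supInner B ω ∂F) (fun l => ?_)
    (integrable_const _)
    (fun l => Eventually.of_forall fun s => abs_ridge_le (fun z => hφ.abs_le_one _) s x) ?_
  · exact (measurable_ridge_left hB hg
      (by fun_prop : Measurable fun z => φ (l * z)) x).aestronglyMeasurable
  · have hae : ∀ᵐ s ∂ridgeMeasure B F, inner ℝ s.1 x - supInner B s.1 * s.2 ≠ 0 := by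
      unfold ridgeMeasure
      rw [Measure.ae_prod_iff_ae_ae]
      · refine Measure.ae_smul_measure ?_ _
        rw [ae_withDensity_iff (by fun_prop)]
        refine Eventually.of_forall fun ω hω => ?_
        have h0 : 0 < supInner B ω := by simpa using hω
        refine Measure.ae_smul_measure (ae_restrict_of_ae ?_) _
        have : ∀ᵐ t : ℝ, t ≠ inner ℝ ω x / supInner B ω := by
          simp [ae_iff]
        filter_upwards [this] with t ht h
        refine ht ?_
        field_simp
        linarith
      · exact (measurableSet_eq_fun (by fun_prop) measurable_const).compl
    filter_upwards [hae] with s hs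
    exact ((hφ.tendsto_stepFun hs).const_mul _).const_mul _

/-- **Barron's approximation theorem** in `L²(μ)`, for sigmoidal activations with values in
`[-1, 1]`. The target is a bounded measurable function `f` on the whole space that agrees with `h`
on `B`, since neither `B` nor `h` need be measurable. -/
lemma IsBarronRep.exists_twoLayerNN (hB : Bornology.IsBounded B)
    (hrep : IsBarronRep B h F g) (hC : 0 < ∫ ω, supInner B ω ∂F)
    {φ : ℝ → ℝ} (hφ : IsSigmoidal φ) (μ : Measure (EuclideanSpace ℝ (Fin d)))
    [IsProbabilityMeasure μ] {k : ℕ} (hk : 0 < k) :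
    ∃ f : EuclideanSpace ℝ (Fin d) → ℝ, Measurable f ∧ (∃ K, ∀ x, |f x| ≤ K) ∧
      (∀ x ∈ B, h x = f x) ∧
      ∀ ε > 0, ∃ N ∈ twoLayerNN φ d k, Measurable N ∧ (∃ K, ∀ x, |N x| ≤ K) ∧
        ∫ x, (f x - N x) ^ 2 ∂μ ≤ (∫ ω, supInner B ω ∂F) ^ 2 / k + ε := by
  have hg := hrep.measurable_phase
  have hφm := hφ.measurable
  have := isProbabilityMeasure_ridgeMeasure hB hrep.integrable_norm hC
  obtain ⟨c₀, hc₀⟩ := hrep.exists_eq_add_integral_ridge hB hC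
  set C := ∫ ω, supInner B ω ∂F with hCdef
  set f₀ : EuclideanSpace ℝ (Fin d) → ℝ := fun x =>
    ∫ s, ridge B F g stepFun s x ∂ridgeMeasure B F with hf₀
  set fl : ℕ → EuclideanSpace ℝ (Fin d) → ℝ := fun l x =>
    ∫ s, ridge B F g (fun z => φ (l * z)) s x ∂ridgeMeasure B F with hfl
  have hf₀m : Measurable f₀ := measurable_mean (measurable_uncurry_ridge hB hg measurable_stepFun)
  have hf₀C : ∀ x, |f₀ x| ≤ C := fun x =>
    abs_integral_le_of_abs_le fun s => abs_ridge_le (fun z => (abs_stepFun z).le) s x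
  have hflm : ∀ l, Measurable (fl l) := fun l =>
    measurable_mean
    (measurable_uncurry_ridge hB hg (by fun_prop : Measurable fun z => φ (l * z)))
  have hflC : ∀ l x, |fl l x| ≤ C := fun l x =>
    abs_integral_le_of_abs_le fun s => abs_ridge_le (fun z => hφ.abs_le_one _) s x
  refine ⟨fun x => c₀ + f₀ x, by fun_prop, ⟨|c₀| + C, fun x =>
    (abs_add_le _ _).trans (by linarith [hf₀C x])⟩, hc₀, fun ε hε => ?_⟩
  have hlim : Tendsto (fun l => ∫ x, (f₀ x - fl l x) ^ 2 ∂μ) atTop (𝓝 (∫ _x, (0 : ℝ) ∂μ)) := by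
    refine tendsto_integral_of_dominated_convergence (fun _ => (C + C) ^ 2) (fun l => ?_)
      (integrable_const _) (fun l => Eventually.of_forall fun x => ?_)
      (Eventually.of_forall fun x => ?_)
    · exact ((hf₀m.sub (hflm l)).pow_const 2).aestronglyMeasurable
    · rw [Real.norm_eq_abs, abs_pow]
      gcongr
      exact (abs_sub _ _).trans (add_le_add (hf₀C x) (hflC l x))
    · have h := tendsto_integral_ridge hB hrep.integrable_norm hg hC hφ x
      have h2 := (h.const_sub (f₀ x)).pow 2
      simpa [hf₀] using h2
  rw [integral_zero] at hlim
  obtain ⟨l, hl⟩ := (hlim.eventually_lt_const hε).exists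
  obtain ⟨s, hs⟩ := exists_integral_sq_sub_average_le (Q := ridgeMeasure B F) (μ := μ)
    (ψ := ridge B F g fun z => φ (l * z)) (M := C)
    (measurable_uncurry_ridge hB hg (by fun_prop : Measurable fun z => φ (l * z)))
    (fun s x => abs_ridge_le (fun z => hφ.abs_le_one _) s x) hf₀m hf₀C hk
  refine ⟨fun x => c₀ + (1 / k : ℝ) * ∑ i, ridge B F g (fun z => φ (l * z)) (s i) x,
    ⟨c₀, fun i => (l : ℝ) • (s i).1, fun i => -(l * (supInner B (s i).1 * (s i).2)),
      fun i => (1 / k : ℝ) * (C * -Real.sin (supInner B (s i).1 * (s i).2 + (g (s i).1).arg)),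
      fun x => ?_⟩, ?_, ⟨|c₀| + |(1 / k : ℝ)| * ∑ _i : Fin k, C, fun x => ?_⟩, ?_⟩
  · simp only [ridge, Finset.mul_sum, real_inner_smul_left, mul_sub, ← hCdef, ← sub_eq_add_neg,
      mul_assoc]
  · refine measurable_const.add (measurable_const.mul (Finset.measurable_sum _ fun i _ => ?_))
    exact measurable_ridge_right (by fun_prop : Measurable fun z => φ (l * z)) _
  · refine (abs_add_le _ _).trans (add_le_add le_rfl ?_)
    rw [abs_mul]
    gcongr
    exact (Finset.abs_sum_le_sum_abs _ _).trans (Finset.sum_le_sum fun i _ =>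
      abs_ridge_le (fun z => hφ.abs_le_one _) _ x)
  · simp only [add_sub_add_left_eq_sub]
    linarith

end Ridge

/-- A network of size `k` whose squared error is controlled by the Barron constant itself. When the
constant vanishes, the function is constant on `B` and is represented exactly. -/
lemma MemBarronClass.exists_twoLayerNN {d : ℕ} {B : Set (EuclideanSpace ℝ (Fin d))}
    (hB : Bornology.IsBounded B) {h : EuclideanSpace ℝ (Fin d) → ℝ} (hh : MemBarronClass B h)
    {φ : ℝ → ℝ} (hφ : IsSigmoidal φ) (μ : Measure (EuclideanSpace ℝ (Fin d)))
    [IsProbabilityMeasure μ] {k : ℕ} (hk : 0 < k) :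
    ∃ f N : EuclideanSpace ℝ (Fin d) → ℝ, Measurable f ∧ (∃ K, ∀ x, |f x| ≤ K) ∧
      (∀ x ∈ B, h x = f x) ∧ N ∈ twoLayerNN φ d k ∧ Measurable N ∧ (∃ K, ∀ x, |N x| ≤ K) ∧
      ∫ x, (f x - N x) ^ 2 ∂μ ≤ 4 * barronConst B h ^ 2 / k + 8 * barronConst B h / √k := by
  set S := {C | ∃ F g, IsBarronRep B h F g ∧ C = ∫ ω, supInner B ω ∂F} with hS
  have hne : S.Nonempty := by
    obtain ⟨F, g, hr⟩ := hh
    exact ⟨_, F, g, hr, rfl⟩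
  have hS0 : ∀ C ∈ S, 0 ≤ C := by
    rintro _ ⟨F, g, -, rfl⟩
    exact integral_nonneg (supInner_nonneg B)
  have hC : barronConst B h = sInf S := rfl
  have hk' : (0 : ℝ) < k := by exact_mod_cast hk
  rcases (Real.sInf_nonneg hS0).eq_or_lt with h0 | h0
  · refine ⟨fun _ => h 0, fun _ => h 0, measurable_const, ⟨_, fun _ => le_rfl⟩, fun x hx => ?_,
      ⟨h 0, 0, 0, 0, by simp⟩, measurable_const, ⟨_, fun _ => le_rfl⟩, ?_⟩
    · have hle : |h x - h 0| ≤ 0 := by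
        rw [h0]
        refine le_csInf hne ?_
        rintro _ ⟨F, g, hr, rfl⟩
        exact hr.abs_sub_le hB hx
      linarith [abs_nonpos_iff.1 hle]
    · simp [hC, ← h0]
  · -- a representation within a factor two of optimal already gives the first term of the bound;
    -- the second term, now positive, pays for steepening the activation
    obtain ⟨C, ⟨F, g, hr, rfl⟩, hlt⟩ := exists_lt_of_csInf_lt hne (by linarith : sInf S < 2 * sInf S)
    have hle : sInf S ≤ ∫ ω, supInner B ω ∂F := csInf_le ⟨0, hS0⟩ ⟨F, g, hr, rfl⟩
    obtain ⟨f, hf, hfb, hhf, hN⟩ := hr.exists_twoLayerNN hB (h0.trans_le hle) hφ μ hk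
    obtain ⟨N, hN, hNm, hNb, hNe⟩ := hN (8 * barronConst B h / √k) (by rw [hC]; positivity)
    refine ⟨f, N, hf, hfb, hhf, hN, hNm, hNb, hNe.trans ?_⟩
    gcongr
    rw [hC]
    nlinarith

/-! ### The regression function and the minimum mean square error -/

section Bayes
variable {Ω : Type*} [MeasurableSpace Ω] {P : Measure Ω} {d : ℕ}
  {X : Ω → EuclideanSpace ℝ (Fin d)} {Y : Ω → ℝ} {B : Set (EuclideanSpace ℝ (Fin d))}
  {fpos fneg : EuclideanSpace ℝ (Fin d) → ℝ} {p : ℝ}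

lemma IsCondDensity.setIntegral_comp [IsProbabilityMeasure P] {A : Set Ω}
    {f : EuclideanSpace ℝ (Fin d) → ℝ}
    (hf : IsCondDensity P X A f) (hX : Measurable X) {u : EuclideanSpace ℝ (Fin d) → ℝ}
    (hu : Measurable u) : ∫ ω in A, u (X ω) ∂P = P.real A * ∫ x, f x * u x := by
  have h1 : ∫ x, u x ∂(ProbabilityTheory.cond P A).map X = ∫ x, f x * u x := by
    have := hf.measurable
    rw [hf.map_eq, integral_withDensity_eq_integral_toReal_smul (by fun_prop)
      (Eventually.of_forall fun _ => ENNReal.ofReal_lt_top)]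
    simp only [ENNReal.toReal_ofReal (hf.nonneg _), smul_eq_mul]
  rw [integral_map hX.aemeasurable hu.aestronglyMeasurable, ProbabilityTheory.cond,
    integral_smul_measure, smul_eq_mul, ENNReal.toReal_inv] at h1
  have hA : P.real A ≠ 0 := by
    rw [measureReal_def, ENNReal.toReal_ne_zero]
    exact ⟨hf.event_ne_zero, measure_ne_top _ _⟩
  rw [← h1, measureReal_def]
  rw [measureReal_def] at hA
  field_simp

lemma IsCondDensity.integrable_mul {A : Set Ω} {f : EuclideanSpace ℝ (Fin d) → ℝ}
    (hf : IsCondDensity P X A f) {u : EuclideanSpace ℝ (Fin d) → ℝ}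
    (hu : Measurable u) {K : ℝ} (hK : ∀ x, |u x| ≤ K) : Integrable (fun x => f x * u x) := by
  have hm := hf.measurable
  have h1 : Integrable u ((ProbabilityTheory.cond P A).map X) :=
    integrable_of_abs_le hu hK
  rw [hf.map_eq, integrable_withDensity_iff_integrable_smul' (by fun_prop)
    (Eventually.of_forall fun _ => ENNReal.ofReal_lt_top)] at h1
  simpa only [ENNReal.toReal_ofReal (hf.nonneg _), smul_eq_mul] using h1

/-- An almost sure property of `X` holds almost everywhere on the support of each conditional
density. -/
lemma IsCondDensity.ae_of_ae {A : Set Ω} {f : EuclideanSpace ℝ (Fin d) → ℝ}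
    (hf : IsCondDensity P X A f) (hX : Measurable X) {q : EuclideanSpace ℝ (Fin d) → Prop}
    (hq : MeasurableSet {x | q x}) (h : ∀ᵐ ω ∂P, q (X ω)) : ∀ᵐ x, f x ≠ 0 → q x := by
  have hm := hf.measurable
  have h1 : ∀ᵐ x ∂(ProbabilityTheory.cond P A).map X, q x := by
    rw [ae_map_iff hX.aemeasurable hq]
    exact ProbabilityTheory.cond_absolutelyContinuous.ae_le h
  rw [hf.map_eq, ae_withDensity_iff (by fun_prop)] at h1
  filter_upwards [h1] with x hx h0
  exact hx (by simpa using (hf.nonneg x).lt_of_ne' h0)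

/-- With `a = p f₊` and `b = (1 - p) f₋`: `tanh θ` is the normalized difference of the class
weights. -/
lemma tanh_half_log_div_mul {a b : ℝ} (ha : 0 < a) (hb : 0 < b) :
    Real.tanh (1 / 2 * Real.log (a / b)) * (a + b) = a - b := by
  have hsq : Real.exp (1 / 2 * Real.log (a / b)) ^ 2 = a / b := by
    rw [← Real.exp_nat_mul, ← Real.exp_log (div_pos ha hb)]
    congr 1; push_cast; rw [Real.exp_log (div_pos ha hb)]; ring
  rw [Real.tanh_eq, Real.exp_neg]
  set e := Real.exp (1 / 2 * Real.log (a / b))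
  have he : 0 < e := Real.exp_pos _
  have hab : a = e ^ 2 * b := by rw [hsq]; field_simp
  rw [hab]
  field_simp

lemma measurable_halfLogRatio (hp : Measurable fpos) (hn : Measurable fneg) :
    Measurable (halfLogRatio p fpos fneg) := by
  unfold halfLogRatio
  fun_prop

lemma integral_eq_add_of_ae_sign (hY : Measurable Y) (hYval : ∀ᵐ ω ∂P, Y ω = 1 ∨ Y ω = -1)
    {v : Ω → ℝ} (hv : Integrable v P) :
    ∫ ω, v ω ∂P = ∫ ω in {ω | Y ω = 1}, v ω ∂P + ∫ ω in {ω | Y ω = -1}, v ω ∂P := by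
  have hs : MeasurableSet {ω | Y ω = 1} := hY (measurableSet_singleton 1)
  rw [← integral_add_compl hs hv]
  congr 1
  refine setIntegral_congr_set ?_
  filter_upwards [hYval] with ω hω
  apply propext
  change ¬ (Y ω = 1) ↔ Y ω = -1
  rcases hω with h | h <;> rw [h] <;> norm_num

lemma one_sub_real_eq [IsProbabilityMeasure P] (hY : Measurable Y)
    (hYval : ∀ᵐ ω ∂P, Y ω = 1 ∨ Y ω = -1) :
    1 - P.real {ω | Y ω = 1} = P.real {ω | Y ω = -1} := by
  have h := integral_eq_add_of_ae_sign hY hYval (integrable_const (1 : ℝ))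
  simp only [integral_const, smul_eq_mul, mul_one, measureReal_restrict_apply_univ,
    probReal_univ] at h
  linarith

/-- `tanh ∘ halfLogRatio` is the regression function: its residual is orthogonal to every bounded
function of `X`. The densities are simultaneously positive wherever one of them does not vanish,
up to a null set; this replaces `X ∈ B`, since `B` need not be measurable. -/
lemma integral_mul_eq_integral_tanh_mul [IsProbabilityMeasure P] (hX : Measurable X)
    (hY : Measurable Y)
    (hYval : ∀ᵐ ω ∂P, Y ω = 1 ∨ Y ω = -1)
    (hfpos : IsCondDensity P X {ω | Y ω = 1} fpos)
    (hfneg : IsCondDensity P X {ω | Y ω = -1} fneg)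
    (hpos : ∀ᵐ ω ∂P, 0 < fpos (X ω) ∧ 0 < fneg (X ω))
    (hp : p = P.real {ω | Y ω = 1}) {q : EuclideanSpace ℝ (Fin d) → ℝ} (hq : Measurable q)
    {K : ℝ} (hK : ∀ x, |q x| ≤ K) :
    ∫ ω, Y ω * q (X ω) ∂P
      = ∫ ω, Real.tanh (halfLogRatio p fpos fneg (X ω)) * q (X ω) ∂P := by
  have hp' : 1 - p = P.real {ω | Y ω = -1} := by rw [hp, one_sub_real_eq hY hYval]
  have hp0 : 0 < p := by
    rw [hp, measureReal_def]
    exact ENNReal.toReal_pos hfpos.event_ne_zero (measure_ne_top _ _)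
  have hp1 : 0 < 1 - p := by
    rw [hp', measureReal_def]
    exact ENNReal.toReal_pos hfneg.event_ne_zero (measure_ne_top _ _)
  have hmp := hfpos.measurable
  have hmn := hfneg.measurable
  have hs : MeasurableSet {ω | Y ω = 1} := hY (measurableSet_singleton 1)
  have hs' : MeasurableSet {ω | Y ω = -1} := hY (measurableSet_singleton (-1))
  set η : EuclideanSpace ℝ (Fin d) → ℝ := fun x => Real.tanh (halfLogRatio p fpos fneg x) with hη
  have hηm : Measurable η := measurable_tanh.comp (measurable_halfLogRatio hmp hmn)
  have hηq : ∀ x, |η x * q x| ≤ K := fun x => by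
    rw [abs_mul]
    exact (mul_le_of_le_one_left (abs_nonneg _) (Real.abs_tanh_lt_one _).le).trans (hK x)
  have hset : MeasurableSet {x | 0 < fpos x ∧ 0 < fneg x} :=
    (measurableSet_lt measurable_const hmp).inter (measurableSet_lt measurable_const hmn)
  have hae : ∀ᵐ x, p * (fpos x * q x) - (1 - p) * (fneg x * q x)
      = p * (fpos x * (η x * q x)) + (1 - p) * (fneg x * (η x * q x)) := by
    filter_upwards [hfpos.ae_of_ae hX hset hpos, hfneg.ae_of_ae hX hset hpos] with x h1 h2
    by_cases h : fpos x = 0 ∧ fneg x = 0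
    · simp [h.1, h.2]
    · have h3 : 0 < fpos x ∧ 0 < fneg x := by
        by_cases h0 : fpos x = 0
        · exact h2 fun h' => h ⟨h0, h'⟩
        · exact h1 h0
      have h4 := tanh_half_log_div_mul (mul_pos hp0 h3.1) (mul_pos hp1 h3.2)
      change η x * _ = _ at h4
      linear_combination (-q x) * h4
  have hiY : Integrable (fun ω => Y ω * q (X ω)) P := by
    refine Integrable.of_bound (C := K) (by fun_prop) ?_
    filter_upwards [hYval] with ω hω
    rw [norm_mul]
    rcases hω with h | h <;> rw [h] <;> simpa using hK (X ω)
  have hiη : Integrable (fun ω => η (X ω) * q (X ω)) P :=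
    integrable_of_abs_le ((hηm.comp hX).mul (hq.comp hX)) fun ω => hηq (X ω)
  have e1 : ∫ ω in {ω | Y ω = 1}, Y ω * q (X ω) ∂P = p * ∫ x, fpos x * q x := by
    rw [hp, ← hfpos.setIntegral_comp hX hq]
    refine setIntegral_congr_fun hs fun ω hω => ?_
    have : Y ω = 1 := hω
    simp [this]
  have e2 : ∫ ω in {ω | Y ω = -1}, Y ω * q (X ω) ∂P = -((1 - p) * ∫ x, fneg x * q x) := by
    rw [hp', ← hfneg.setIntegral_comp hX hq, ← integral_neg]
    refine setIntegral_congr_fun hs' fun ω hω => ?_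
    have : Y ω = -1 := hω
    simp [this]
  have e3 := hfpos.setIntegral_comp hX (hηm.mul hq)
  have e4 := hfneg.setIntegral_comp hX (hηm.mul hq)
  simp only [Pi.mul_apply] at e3 e4
  rw [integral_eq_add_of_ae_sign hY hYval hiY, e1, e2,
    integral_eq_add_of_ae_sign hY hYval hiη, e3, e4, ← hp, ← hp']
  rw [← sub_eq_add_neg, ← integral_const_mul, ← integral_const_mul, ← integral_const_mul,
    ← integral_const_mul, ← integral_sub, ← integral_add]
  · exact integral_congr_ae hae
  · exact (hfpos.integrable_mul (hηm.mul hq) hηq).const_mul _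
  · exact (hfneg.integrable_mul (hηm.mul hq) hηq).const_mul _
  · exact (hfpos.integrable_mul hq hK).const_mul _
  · exact (hfneg.integrable_mul hq hK).const_mul _

lemma sq_sub_le_four {y q : ℝ} (hy : y = 1 ∨ y = -1) (hq : |q| ≤ 1) : (y - q) ^ 2 ≤ 4 := by
  have := abs_le.1 hq
  rcases hy with rfl | rfl <;> nlinarith

lemma integrable_sq_sub [IsProbabilityMeasure P] (hX : Measurable X)
    (hY : Measurable Y)
    (hYval : ∀ᵐ ω ∂P, Y ω = 1 ∨ Y ω = -1) {q : EuclideanSpace ℝ (Fin d) → ℝ} (hq : Measurable q)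
    (hq1 : ∀ x, |q x| ≤ 1) : Integrable (fun ω => (Y ω - q (X ω)) ^ 2) P := by
  refine Integrable.of_bound (C := 4) (by fun_prop) ?_
  filter_upwards [hYval] with ω hω
  rw [Real.norm_of_nonneg (sq_nonneg _)]
  exact sq_sub_le_four hω (hq1 _)

/-- Pythagoras for the regression function. -/
lemma integral_sq_sub_eq_add [IsProbabilityMeasure P] (hX : Measurable X)
    (hY : Measurable Y)
    (hYval : ∀ᵐ ω ∂P, Y ω = 1 ∨ Y ω = -1)
    (hfpos : IsCondDensity P X {ω | Y ω = 1} fpos)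
    (hfneg : IsCondDensity P X {ω | Y ω = -1} fneg)
    (hpos : ∀ᵐ ω ∂P, 0 < fpos (X ω) ∧ 0 < fneg (X ω))
    (hp : p = P.real {ω | Y ω = 1}) {q : EuclideanSpace ℝ (Fin d) → ℝ} (hq : Measurable q)
    (hq1 : ∀ x, |q x| ≤ 1) :
    ∫ ω, (Y ω - q (X ω)) ^ 2 ∂P
      = ∫ ω, (Y ω - Real.tanh (halfLogRatio p fpos fneg (X ω))) ^ 2 ∂P
        + ∫ ω, (Real.tanh (halfLogRatio p fpos fneg (X ω)) - q (X ω)) ^ 2 ∂P := by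
  set η : EuclideanSpace ℝ (Fin d) → ℝ := fun x => Real.tanh (halfLogRatio p fpos fneg x) with hη
  have hηm : Measurable η :=
    measurable_tanh.comp (measurable_halfLogRatio hfpos.measurable hfneg.measurable)
  have hη1 : ∀ x, |η x| ≤ 1 := fun x => (Real.abs_tanh_lt_one _).le
  have hr : ∀ x, |η x - q x| ≤ 2 := fun x =>
    (abs_sub _ _).trans (by linarith [hη1 x, hq1 x])
  have horth := integral_mul_eq_integral_tanh_mul hX hY hYval hfpos hfneg hpos hp
    (hηm.sub hq) hr
  change _ = ∫ ω, η (X ω) * (η - q) (X ω) ∂P at horth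
  simp only [Pi.sub_apply] at horth
  have i1 : Integrable (fun ω => (Y ω - η (X ω)) ^ 2) P := integrable_sq_sub hX hY hYval hηm hη1
  have i2 : Integrable (fun ω => (η (X ω) - q (X ω)) ^ 2) P := by
    refine integrable_of_abs_le (by fun_prop) (M := 2 ^ 2) fun ω => ?_
    rw [abs_pow]; gcongr; exact hr _
  have i3 : Integrable (fun ω => Y ω * (η (X ω) - q (X ω))) P := by
    refine Integrable.of_bound (C := 2) (by fun_prop) ?_
    filter_upwards [hYval] with ω hω
    rw [norm_mul]
    rcases hω with h | h <;> rw [h] <;> simpa using hr (X ω)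
  have i4 : Integrable (fun ω => η (X ω) * (η (X ω) - q (X ω))) P := by
    refine integrable_of_abs_le (by fun_prop) (M := 2) fun ω => ?_
    rw [abs_mul]
    exact (mul_le_of_le_one_left (abs_nonneg _) (hη1 _)).trans (hr _)
  have e : ∀ ω, (Y ω - q (X ω)) ^ 2 = ((Y ω - η (X ω)) ^ 2 + (η (X ω) - q (X ω)) ^ 2)
      + 2 * (Y ω * (η (X ω) - q (X ω)) - η (X ω) * (η (X ω) - q (X ω))) := fun ω => by ring
  have i5 : Integrable (fun ω => (Y ω - η (X ω)) ^ 2 + (η (X ω) - q (X ω)) ^ 2) P := i1.add i2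
  have i6 : Integrable (fun ω => 2 * (Y ω * (η (X ω) - q (X ω))
      - η (X ω) * (η (X ω) - q (X ω)))) P := (i3.sub i4).const_mul 2
  rw [integral_congr_ae (Eventually.of_forall e), integral_add i5 i6,
    integral_const_mul, integral_sub i3 i4, horth, integral_add i1 i2]
  ring

/-- The regression function attains the minimum mean square error. A competitor may have infinite
loss; truncating it to `[-1, 1]` only lowers the loss. -/
lemma integral_sq_sub_tanh_le_mmse [IsProbabilityMeasure P] (hX : Measurable X)
    (hY : Measurable Y)
    (hYval : ∀ᵐ ω ∂P, Y ω = 1 ∨ Y ω = -1)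
    (hfpos : IsCondDensity P X {ω | Y ω = 1} fpos)
    (hfneg : IsCondDensity P X {ω | Y ω = -1} fneg)
    (hpos : ∀ᵐ ω ∂P, 0 < fpos (X ω) ∧ 0 < fneg (X ω))
    (hp : p = P.real {ω | Y ω = 1}) :
    ∫ ω, (Y ω - Real.tanh (halfLogRatio p fpos fneg (X ω))) ^ 2 ∂P ≤ mmse P X Y := by
  unfold mmse
  rw [← ENNReal.ofReal_le_iff_le_toReal]
  · refine le_iInf fun h => ?_
    obtain ⟨h, hm⟩ := h
    set q : EuclideanSpace ℝ (Fin d) → ℝ := fun x => max (-1) (min 1 (h x)) with hq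
    have hqm : Measurable q := by fun_prop
    have hq1 : ∀ x, |q x| ≤ 1 := fun x =>
      abs_le.2 ⟨le_max_left _ _, max_le (by norm_num) (min_le_left _ _)⟩
    have h1 := integral_sq_sub_eq_add hX hY hYval hfpos hfneg hpos hp hqm hq1
    have h2 : 0 ≤ ∫ ω, (Real.tanh (halfLogRatio p fpos fneg (X ω)) - q (X ω)) ^ 2 ∂P :=
      integral_nonneg fun _ => sq_nonneg _
    refine (ENNReal.ofReal_le_ofReal (by linarith : _ ≤ ∫ ω, (Y ω - q (X ω)) ^ 2 ∂P)).trans ?_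
    rw [ofReal_integral_eq_lintegral_ofReal (integrable_sq_sub hX hY hYval hqm hq1)
      (Eventually.of_forall fun _ => sq_nonneg _)]
    refine lintegral_mono_ae ?_
    filter_upwards [hYval] with ω hω
    refine ENNReal.ofReal_le_ofReal ?_
    change (Y ω - max (-1) (min 1 (h (X ω)))) ^ 2 ≤ (Y ω - h (X ω)) ^ 2
    rcases le_total (h (X ω)) 1 with ha | ha <;> rcases le_total (-1) (h (X ω)) with hb | hb
    · rw [min_eq_right ha, max_eq_right hb]
    · rw [min_eq_right ha, max_eq_left hb]
      rcases hω with h | h <;> rw [h] <;> nlinarith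
    · rw [min_eq_left ha, max_eq_right (by norm_num)]
      rcases hω with h | h <;> rw [h] <;> nlinarith
    · linarith
  · refine ne_top_of_le_ne_top ?_ (iInf_le _ ⟨fun _ => (0 : ℝ), measurable_const⟩)
    have hi := integrable_sq_sub (q := fun _ => (0 : ℝ)) hX hY hYval measurable_const (by simp)
    rw [← ofReal_integral_eq_lintegral_ofReal hi (Eventually.of_forall fun _ => sq_nonneg _)]
    exact ENNReal.ofReal_ne_top

end Bayes

/-! ### Concentration of the empirical loss -/

/-- **Hoeffding's inequality** for the empirical square loss of one fixed predictor with values in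
`[-1, 1]`. The losses lie in `[0, 4]`, hence are sub-Gaussian with variance proxy `4`. -/
lemma exists_event_empirical_loss_le {Ω : Type*} [MeasurableSpace Ω] {P : Measure Ω}
    [IsProbabilityMeasure P] {d n : ℕ} (hn : 0 < n)
    {X : Ω → EuclideanSpace ℝ (Fin d)} {Y : Ω → ℝ}
    (hYval : ∀ᵐ ω ∂P, Y ω = 1 ∨ Y ω = -1)
    {Xs : Fin n → Ω → EuclideanSpace ℝ (Fin d)} {Ys : Fin n → Ω → ℝ}
    (hXs : ∀ i, Measurable (Xs i)) (hYs : ∀ i, Measurable (Ys i))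
    (hindep : ProbabilityTheory.iIndepFun (fun i ω => (Xs i ω, Ys i ω)) P)
    (hident : ∀ i, ProbabilityTheory.IdentDistrib
      (fun ω => (Xs i ω, Ys i ω)) (fun ω => (X ω, Y ω)) P P)
    {q : EuclideanSpace ℝ (Fin d) → ℝ} (hq : Measurable q) (hq1 : ∀ x, |q x| ≤ 1)
    {δ : ℝ} (hδ0 : 0 < δ) (hδ1 : δ ≤ 1) :
    ∃ E : Set Ω, MeasurableSet E ∧ ENNReal.ofReal (1 - δ) ≤ P E ∧
      ∀ ω ∈ E, (1 / (n : ℝ)) * ∑ i, (Ys i ω - q (Xs i ω)) ^ 2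
        ≤ ∫ ω, (Y ω - q (X ω)) ^ 2 ∂P + 2 * √(2 * Real.log (1 / δ) / n) := by
  have hn' : (0 : ℝ) < n := by exact_mod_cast hn
  set L : EuclideanSpace ℝ (Fin d) × ℝ → ℝ := fun z => (z.2 - q z.1) ^ 2 with hL
  have hLm : Measurable L := by fun_prop
  set m := ∫ ω, (Y ω - q (X ω)) ^ 2 ∂P with hm
  set t := 2 * √(2 * Real.log (1 / δ) / n) with ht
  have ht0 : 0 ≤ t := by positivity
  have hmean : ∀ i, ∫ ω, (Ys i ω - q (Xs i ω)) ^ 2 ∂P = m := fun i =>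
    ((hident i).comp hLm).integral_eq
  have hYsval : ∀ i, ∀ᵐ ω ∂P, Ys i ω = 1 ∨ Ys i ω = -1 := fun i => by
    have hset : MeasurableSet {z : EuclideanSpace ℝ (Fin d) × ℝ | z.2 = 1 ∨ z.2 = -1} :=
      (measurableSet_eq_fun measurable_snd measurable_const).union
        (measurableSet_eq_fun measurable_snd measurable_const)
    exact (hident i).symm.ae_mem_snd hset hYval
  have hsub : ∀ i ∈ (Finset.univ : Finset (Fin n)), ProbabilityTheory.HasSubgaussianMGF
      (fun ω => (Ys i ω - q (Xs i ω)) ^ 2 - m) ((‖(4 : ℝ) - 0‖₊ / 2) ^ 2) P := fun i _ => by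
    have h1 := hXs i
    have h2 := hYs i
    have := ProbabilityTheory.hasSubgaussianMGF_of_mem_Icc (μ := P) (a := 0) (b := 4)
      (X := fun ω => (Ys i ω - q (Xs i ω)) ^ 2) (by fun_prop) (by
        filter_upwards [hYsval i] with ω hω
        exact ⟨sq_nonneg _, sq_sub_le_four hω (hq1 _)⟩)
    simpa only [hmean i] using this
  have hind : ProbabilityTheory.iIndepFun (fun i ω => (Ys i ω - q (Xs i ω)) ^ 2 - m) P :=
    hindep.comp (fun _ z => L z - m) fun _ => hLm.sub_const m
  have hoeff := ProbabilityTheory.HasSubgaussianMGF.measure_sum_ge_le_of_iIndepFun hind hsub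
    (ε := n * t) (by positivity)
  have hexp : Real.exp (-(n * t) ^ 2 / (2 * ((∑ _i : Fin n, (‖(4 : ℝ) - 0‖₊ / 2) ^ 2 : NNReal) : ℝ)))
      = δ := by
    have hc : ((∑ _i : Fin n, (‖(4 : ℝ) - 0‖₊ / 2) ^ 2 : NNReal) : ℝ) = n * 4 := by
      simp only [Finset.sum_const, Finset.card_univ, Fintype.card_fin]
      push_cast
      norm_num
    have hlog : 0 ≤ Real.log (1 / δ) := Real.log_nonneg (by rw [le_div_iff₀ hδ0]; linarith)
    have hsq : (n * t) ^ 2 = 8 * n * Real.log (1 / δ) := by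
      rw [ht, mul_pow, mul_pow, Real.sq_sqrt (by positivity)]
      field_simp
      ring
    rw [hc, hsq]
    have : -(8 * n * Real.log (1 / δ)) / (2 * (n * 4)) = Real.log δ := by
      rw [one_div, Real.log_inv]
      field_simp
      ring
    rw [this, Real.exp_log hδ0]
  rw [hexp] at hoeff
  set A := {ω | (n : ℝ) * t ≤ ∑ i, ((Ys i ω - q (Xs i ω)) ^ 2 - m)} with hA
  have hAm : MeasurableSet A := by
    refine measurableSet_le measurable_const (Finset.measurable_sum _ fun i _ => ?_)
    have h1 := hXs i
    have h2 := hYs i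
    fun_prop
  refine ⟨Aᶜ, hAm.compl, ?_, fun ω hω => ?_⟩
  · rw [← ofReal_measureReal, probReal_compl_eq_one_sub hAm]
    exact ENNReal.ofReal_le_ofReal (by linarith)
  · have h1 : ∑ i, ((Ys i ω - q (Xs i ω)) ^ 2 - m) < n * t := not_le.1 hω
    rw [Finset.sum_sub_distrib, Finset.sum_const, Finset.card_univ, Fintype.card_fin,
      nsmul_eq_mul] at h1
    rw [one_div, inv_mul_le_iff₀ hn']
    linarith

/-! ### The bound -/

theorem theorem2 {Ω : Type*} [MeasurableSpace Ω] (P : Measure Ω) [IsProbabilityMeasure P]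
    {d : ℕ} (k n : ℕ) (hk : 0 < k) (hn : 0 < n)
    (φ : ℝ → ℝ) (hφ : IsSigmoidal φ)
    (B : Set (EuclideanSpace ℝ (Fin d))) (hB : Bornology.IsBounded B) (hB0 : 0 ∈ B)
    (X : Ω → EuclideanSpace ℝ (Fin d)) (Y : Ω → ℝ) (hX : Measurable X) (hY : Measurable Y)
    (hYval : ∀ᵐ ω ∂P, Y ω = 1 ∨ Y ω = -1) (hXB : ∀ᵐ ω ∂P, X ω ∈ B)
    (fpos fneg : EuclideanSpace ℝ (Fin d) → ℝ)
    (hfpos : IsCondDensity P X {ω | Y ω = 1} fpos)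
    (hfneg : IsCondDensity P X {ω | Y ω = -1} fneg)
    (hfpos_pos : ∀ x ∈ B, 0 < fpos x) (hfneg_pos : ∀ x ∈ B, 0 < fneg x)
    (p : ℝ) (hp : p = P.real {ω | Y ω = 1})
    (θ : EuclideanSpace ℝ (Fin d) → ℝ) (hθ : ∀ x ∈ B, θ x = halfLogRatio p fpos fneg x)
    (hθB : MemBarronClass B θ)
    (Xs : Fin n → Ω → EuclideanSpace ℝ (Fin d)) (Ys : Fin n → Ω → ℝ)
    (hXs : ∀ i, Measurable (Xs i)) (hYs : ∀ i, Measurable (Ys i))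
    (hindep : ProbabilityTheory.iIndepFun (fun i ω => (Xs i ω, Ys i ω)) P)
    (hident : ∀ i, ProbabilityTheory.IdentDistrib
      (fun ω => (Xs i ω, Ys i ω)) (fun ω => (X ω, Y ω)) P P)
    (δ : ℝ) (hδ0 : 0 < δ) (hδ1 : δ ≤ 1) :
    ∃ E : Set Ω, MeasurableSet E ∧ ENNReal.ofReal (1 - δ) ≤ P E ∧
      ∀ ω ∈ E,
        empiricalTanhMMSE φ k (fun i => Xs i ω) (fun i => Ys i ω)
            - (2 * √(2 * Real.log (1 / δ) / n) + 4 * barronConst B θ ^ 2 / k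
                + 8 * barronConst B θ / √k)
          ≤ mmse P X Y := by
  have hμ : IsProbabilityMeasure (P.map X) := Measure.isProbabilityMeasure_map hX.aemeasurable
  have hpos : ∀ᵐ ω ∂P, 0 < fpos (X ω) ∧ 0 < fneg (X ω) := by
    filter_upwards [hXB] with ω hω
    exact ⟨hfpos_pos _ hω, hfneg_pos _ hω⟩
  obtain ⟨f, N, hf, ⟨K, hK⟩, hθf, hN, hNm, ⟨K', hK'⟩, hNe⟩ :=
    hθB.exists_twoLayerNN hB hφ (P.map X) hk
  rw [integral_map hX.aemeasurable
    (by fun_prop : Measurable fun x => (f x - N x) ^ 2).aestronglyMeasurable] at hNe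
  have hqm : Measurable fun x => Real.tanh (N x) := measurable_tanh.comp hNm
  have hq1 : ∀ x, |Real.tanh (N x)| ≤ 1 := fun x => (Real.abs_tanh_lt_one _).le
  have hloss : ∫ ω, (Real.tanh (halfLogRatio p fpos fneg (X ω)) - Real.tanh (N (X ω))) ^ 2 ∂P
      ≤ ∫ ω, (f (X ω) - N (X ω)) ^ 2 ∂P := by
    refine integral_mono_of_nonneg (Eventually.of_forall fun _ => sq_nonneg _) ?_ ?_
    · refine integrable_of_abs_le (by fun_prop) (M := (K + K') ^ 2) fun ω => ?_
      rw [abs_pow]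
      gcongr
      exact (abs_sub _ _).trans (add_le_add (hK _) (hK' _))
    · filter_upwards [hXB] with ω hω
      rw [← hθ _ hω, hθf _ hω]
      exact sq_le_sq.2 (abs_tanh_sub_tanh_le _ _)
  have hpyth := integral_sq_sub_eq_add hX hY hYval hfpos hfneg hpos hp hqm hq1
  have hbayes := integral_sq_sub_tanh_le_mmse hX hY hYval hfpos hfneg hpos hp
  obtain ⟨E, hE, hPE, hle⟩ := exists_event_empirical_loss_le hn hYval hXs hYs hindep hident
    hqm hq1 hδ0 hδ1
  refine ⟨E, hE, hPE, fun ω hω => ?_⟩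
  have hemp : empiricalTanhMMSE φ k (fun i => Xs i ω) (fun i => Ys i ω)
      ≤ (1 / (n : ℝ)) * ∑ i, (Ys i ω - Real.tanh (N (Xs i ω))) ^ 2 := by
    refine ciInf_le ⟨0, ?_⟩ (⟨N, hN⟩ : twoLayerNN φ d k)
    rintro _ ⟨h, rfl⟩
    positivity
  have := hle ω hω
  linarith
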